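/- Let $\mathbb{F}$ be $\mathbb{R}$ or $\mathbb{C}$, and let $p,q\in[1,\infty]$ with $p\neq q$. Let $L_p$ be the space of (classes of) $p$-integrable (essentially bounded if $p=\infty$) $\mathbb{F}$-valued functions on $[0,1]$ with Lebesgue measure, and let $L_q(L_p)$ be the Banach space of (classes of) strongly measurable functions $f\colon[0,1]\to L_p$ such that $t\mapsto\|f(t)\|_{L_p}$ has finite $L_q$-norm on $[0,1]$ with Lebesgue measure, with norm $\|f\|=\bigl\|\,\|f(\cdot)\|_{L_p}\bigr\|_{L_q}$. Then $L_q(L_p)$ is complemented in its bidual, that is, there is a bounded linear map $P\colon L_q(L_p)^{**}\to L_q(L_p)$ with $P\circ J=\mathrm{Id}$, where $J\colon L_q(L_p)\to L_q(L_p)^{**}$ is the canonical embedding, if and only if $p<\infty$. -/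

import Mathlib

set_option maxSynthPendingDepth 3

open MeasureTheory
open scoped ENNReal

/-- A normed space `X` is complemented in its bidual: there is a bounded linear map
`P : X** → X` that is a left inverse of the canonical embedding `X → X**`
(equivalently, for a Banach space `X`, the canonical copy of `X` is the range of a bounded
linear projection on `X**`). -/
def IsComplementedInBidual (𝕜 : Type*) [RCLike 𝕜] (X : Type*) [NormedAddCommGroup X]
    [NormedSpace 𝕜 X] : Prop :=
  ∃ P : StrongDual 𝕜 (StrongDual 𝕜 X) →L[𝕜] X,
    ∀ x : X, P (NormedSpace.inclusionInDoubleDual 𝕜 X x) = x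

/-- The mixed-norm Lebesgue space `L_q(L_p)`: classes of strongly measurable functions
`f : [0,1] → L_p([0,1])` for which `t ↦ ‖f t‖_p` has finite `L_q([0,1])` norm, both copies of
`[0,1]` carrying Lebesgue measure. The inner index `p` comes first. -/
abbrev MixedLp (𝕜 : Type*) [RCLike 𝕜] (p q : ℝ≥0∞) [Fact (1 ≤ p)] : Type _ :=
  Lp (Lp 𝕜 p (volume : Measure unitInterval)) q (volume : Measure unitInterval)

/-!
For `p = ∞`, the disjoint indicators `e n` span a copy of `c₀` in `L_∞`, and the functions
`√2 cos (2π(n + 1)s) ⊗ e n` span a *complemented* copy of `c₀` in `L_q(L_∞)` when `q < ∞`: the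
coefficient functionals are `f ↦ ∫ √2 cos (2π(n + 1)s) φ n (f s) ds` with `φ n` biorthogonal to
`e n`, and these tend to `0` because the cosines are orthonormal and bounded (Emmanuele). A
projection from the bidual would then make `c₀` complemented in `ℓ_∞`, contradicting Phillips'
theorem, which is proved by Whitley's argument with an uncountable almost disjoint family.

For `p < ∞`, an element of the bidual of `L_q(L_p)` restricts to a finitely additive set function on
rectangles. Its densities along a refining sequence of finite partitions into rectangles form an
`L_1`-bounded martingale, and by Fatou's lemma the almost everywhere limit lies in `L_q(L_p)`. This
limit is the value of the projection; at the canonical image of `f` it is `f`, by Lévy's upward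
theorem.
-/

open Filter Topology
open scoped BoundedContinuousFunction

section UnconditionalBound

variable {𝕜 X ι : Type*} [RCLike 𝕜] [NormedAddCommGroup X] [NormedSpace 𝕜 X]

theorem sum_norm_le_of_norm_sum_mul_le {F : Finset ι} {z : ι → 𝕜} {C : ℝ}
    (h : ∀ a : ι → 𝕜, (∀ i, ‖a i‖ ≤ 1) → ‖∑ i ∈ F, a i * z i‖ ≤ C) : ∑ i ∈ F, ‖z i‖ ≤ C := by
  choose a ha haz using fun i => RCLike.exists_norm_eq_mul_self (z i)
  have hsum := h a fun i => (ha i).le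
  rwa [← Finset.sum_congr rfl fun i _ => haz i, ← RCLike.ofReal_sum, RCLike.norm_ofReal,
    abs_of_nonneg (Finset.sum_nonneg fun i _ => norm_nonneg _)] at hsum

theorem norm_sum_mul_indicator_le_one {α : Type*} {F : Finset ι} {A : ι → Set α} {x : α}
    (hx : ∀ i ∈ F, ∀ j ∈ F, x ∈ A i → x ∈ A j → i = j) {a : ι → 𝕜} (ha : ∀ i, ‖a i‖ ≤ 1) :
    ‖∑ i ∈ F, a i * (A i).indicator 1 x‖ ≤ 1 := by
  by_cases hex : ∃ i ∈ F, x ∈ A i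
  · obtain ⟨i, hi, hxi⟩ := hex
    rw [Finset.sum_eq_single_of_mem i hi fun j hj hji => by
      rw [Set.indicator_of_notMem fun hxj => hji (hx j hj i hi hxj hxi), mul_zero]]
    simpa [hxi] using ha i
  · push Not at hex
    rw [Finset.sum_eq_zero fun i hi => by rw [Set.indicator_of_notMem (hex i hi), mul_zero]]
    simp

/-- The finite sums `∑ aᵢ uᵢ` with coefficients in the unit disc are bounded by `C`. For
sequences this says quantitatively that `∑ uᵢ` is weakly unconditionally Cauchy, that is, that
`eᵢ ↦ uᵢ` extends to an operator `c_0 → X` of norm at most `C`. -/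
def HasUnconditionalBound (𝕜 : Type*) [RCLike 𝕜] [NormedSpace 𝕜 X] (u : ι → X) (C : ℝ) : Prop :=
  ∀ (F : Finset ι) (a : ι → 𝕜), (∀ i, ‖a i‖ ≤ 1) → ‖∑ i ∈ F, a i • u i‖ ≤ C

namespace HasUnconditionalBound

variable {u : ι → X} {C : ℝ}

theorem nonneg (hu : HasUnconditionalBound 𝕜 u C) : 0 ≤ C := by
  simpa using hu ∅ 0 (by simp)

theorem norm_sum_smul_le (hu : HasUnconditionalBound 𝕜 u C) (F : Finset ι) {a : ι → 𝕜} {M : ℝ}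
    (hM : 0 ≤ M) (ha : ∀ i, ‖a i‖ ≤ M) : ‖∑ i ∈ F, a i • u i‖ ≤ M * C := by
  obtain rfl | hM := hM.eq_or_lt
  · simp [fun i => norm_le_zero_iff.1 (ha i)]
  have h := hu F (fun i => (M : 𝕜)⁻¹ * a i) fun i => by
    rw [norm_mul, norm_inv, RCLike.norm_of_nonneg hM.le, inv_mul_le_one₀ hM]
    exact ha i
  simpa only [mul_smul, ← Finset.smul_sum, norm_smul, norm_inv, RCLike.norm_of_nonneg hM.le,
    inv_mul_le_iff₀ hM] using h

theorem smul (hu : HasUnconditionalBound 𝕜 u C) {r : ι → 𝕜} {M : ℝ} (hM : 0 ≤ M)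
    (hr : ∀ i, ‖r i‖ ≤ M) : HasUnconditionalBound 𝕜 (fun i => r i • u i) (M * C) := fun F a ha => by
  simp only [smul_smul]
  exact hu.norm_sum_smul_le F hM fun i => by
    rw [norm_mul]
    exact (mul_le_of_le_one_left (norm_nonneg _) (ha i)).trans (hr i)

theorem sum_norm_dual_apply_le (hu : HasUnconditionalBound 𝕜 u C) (φ : StrongDual 𝕜 X)
    (F : Finset ι) : ∑ i ∈ F, ‖φ (u i)‖ ≤ C * ‖φ‖ :=
  sum_norm_le_of_norm_sum_mul_le fun a ha => by
    simpa [mul_comm C] using φ.le_opNorm_of_le (hu F a ha)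

theorem summable_mul_dual_apply (hu : HasUnconditionalBound 𝕜 u C) {a : ι → 𝕜} {M : ℝ}
    (ha : ∀ i, ‖a i‖ ≤ M) (φ : StrongDual 𝕜 X) : Summable fun i => a i * φ (u i) := by
  have hφ : Summable fun i => ‖φ (u i)‖ :=
    summable_of_sum_le (fun _ => norm_nonneg _) (hu.sum_norm_dual_apply_le φ)
  refine Summable.of_norm_bounded (hφ.mul_left M) fun i => ?_
  rw [norm_mul]
  gcongr
  exact ha i

theorem norm_tsum_mul_dual_apply_le (hu : HasUnconditionalBound 𝕜 u C) {a : ι → 𝕜} {M : ℝ}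
    (hM : 0 ≤ M) (ha : ∀ i, ‖a i‖ ≤ M) (φ : StrongDual 𝕜 X) :
    ‖∑' i, a i * φ (u i)‖ ≤ C * M * ‖φ‖ := by
  refine le_of_tendsto (hu.summable_mul_dual_apply ha φ).hasSum.norm
    (Eventually.of_forall fun F => ?_)
  have hφ := φ.le_opNorm_of_le (hu.norm_sum_smul_le F hM ha)
  simp only [map_sum, map_smul, smul_eq_mul] at hφ
  linarith

theorem exists_bidual_sum [TopologicalSpace ι] (hu : HasUnconditionalBound 𝕜 u C) :
    ∃ T : (ι →ᵇ 𝕜) →L[𝕜] StrongDual 𝕜 (StrongDual 𝕜 X), ∀ a φ, T a φ = ∑' i, a i * φ (u i) := by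
  have hs : ∀ (a : ι →ᵇ 𝕜) (φ : StrongDual 𝕜 X), Summable fun i => a i * φ (u i) :=
    fun a φ => hu.summable_mul_dual_apply a.norm_coe_le_norm φ
  let B : (ι →ᵇ 𝕜) →ₗ[𝕜] StrongDual 𝕜 X →ₗ[𝕜] 𝕜 :=
    LinearMap.mk₂ 𝕜 (fun a φ => ∑' i, a i * φ (u i))
      (fun a b φ => by
        simpa only [BoundedContinuousFunction.coe_add, Pi.add_apply, add_mul]
          using (hs a φ).tsum_add (hs b φ))
      (fun c a φ => by
        simpa only [BoundedContinuousFunction.coe_smul, smul_eq_mul, mul_assoc]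
          using tsum_mul_left)
      (fun a φ ψ => by simpa only [add_apply, mul_add] using (hs a φ).tsum_add (hs a ψ))
      (fun c a φ => by
        simpa only [smul_apply, smul_eq_mul, mul_left_comm _ c] using tsum_mul_left)
  exact ⟨B.mkContinuous₂ C fun a φ =>
    hu.norm_tsum_mul_dual_apply_le (norm_nonneg a) a.norm_coe_le_norm φ, fun _ _ => rfl⟩

end HasUnconditionalBound

end UnconditionalBound

section Phillips

theorem exists_uncountable_almostDisjoint : ∃ A : (ℕ → Bool) → Set ℕ,
    (∀ x, (A x).Infinite) ∧ Pairwise fun x y => (A x ∩ A y).Finite := by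
  -- The codes of the finite initial segments of `x`: two branches of the binary tree share only
  -- the nodes below their splitting point.
  let node (x : ℕ → Bool) (n : ℕ) : ℕ := Encodable.encode (List.ofFn fun i : Fin n => x i)
  have length_eq {x y : ℕ → Bool} {m n : ℕ} (h : node x m = node y n) : m = n := by
    simpa using congrArg List.length (Encodable.encode_injective h)
  refine ⟨fun x => Set.range (node x),
    fun x => Set.infinite_range_of_injective fun m n => length_eq, fun x y hxy => ?_⟩
  obtain ⟨k, hk⟩ := Function.ne_iff.1 hxy
  refine ((Set.finite_Iic k).image (node x)).subset ?_
  rintro _ ⟨⟨n, rfl⟩, m, hm⟩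
  refine ⟨n, Set.mem_Iic.2 (not_lt.1 fun hkn => hk ?_), rfl⟩
  obtain rfl := length_eq hm
  exact (congrFun (List.ofFn_injective (Encodable.encode_injective hm)) ⟨k, hkn⟩).symm

variable (𝕜 : Type*) [RCLike 𝕜]

/-- The indicator function of a set of natural numbers, as an element of `ℓ_∞`, here encoded as
the space of bounded (continuous) functions on the discrete space `ℕ`. -/
noncomputable def indicatorSeq (A : Set ℕ) : ℕ →ᵇ 𝕜 :=
  BoundedContinuousFunction.ofNormedAddCommGroupDiscrete (A.indicator 1) 1 fun n => by
    by_cases h : n ∈ A <;> simp [h]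

variable {𝕜}

theorem indicatorSeq_apply (A : Set ℕ) (n : ℕ) : indicatorSeq 𝕜 A n = A.indicator 1 n := rfl

theorem norm_apply_le_of_finite {S : StrongDual 𝕜 (ℕ →ᵇ 𝕜)} (hS : ∀ n, S (indicatorSeq 𝕜 {n}) = 0)
    {a : ℕ →ᵇ 𝕜} {C : ℝ} (hC : 0 ≤ C) (ha : {n | C < ‖a n‖}.Finite) : ‖S a‖ ≤ ‖S‖ * C := by
  set b : ℕ →ᵇ 𝕜 := a - ∑ n ∈ ha.toFinset, a n • indicatorSeq 𝕜 {n} with hb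
  have hSb : S b = S a := by simp [hb, hS]
  have hb_apply (n : ℕ) : b n = if C < ‖a n‖ then 0 else a n := by
    simp only [hb, BoundedContinuousFunction.coe_sub, BoundedContinuousFunction.coe_sum,
      BoundedContinuousFunction.coe_smul, Pi.sub_apply, Finset.sum_apply, indicatorSeq_apply,
      Set.indicator_apply, Set.mem_singleton_iff, Pi.one_apply, smul_eq_mul, mul_ite, mul_one,
      mul_zero, Finset.sum_ite_eq, Set.Finite.mem_toFinset, Set.mem_ofPred_eq]
    split_ifs <;> simp
  rw [← hSb]
  refine S.le_opNorm_of_le ((b.norm_le hC).2 fun n => ?_)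
  rw [hb_apply]
  split_ifs with hn
  · simpa using hC
  · exact not_lt.1 hn

theorem countable_apply_indicatorSeq_ne_zero {ι : Type*} {A : ι → Set ℕ}
    (hA : Pairwise fun i j => (A i ∩ A j).Finite) {S : StrongDual 𝕜 (ℕ →ᵇ 𝕜)}
    (hS : ∀ n, S (indicatorSeq 𝕜 {n}) = 0) : {i | S (indicatorSeq 𝕜 (A i)) ≠ 0}.Countable := by
  suffices hsum : ∀ F : Finset ι, ∑ i ∈ F, ‖S (indicatorSeq 𝕜 (A i))‖ ≤ ‖S‖ by
    simpa [Function.support] using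
      (summable_of_sum_le (fun _ => norm_nonneg _) hsum).countable_support
  refine fun F => sum_norm_le_of_norm_sum_mul_le fun a ha => ?_
  have hoverlap : (⋃ i ∈ F, ⋃ j ∈ F, ⋃ _ : i ≠ j, A i ∩ A j).Finite :=
    F.finite_toSet.biUnion fun i _ => F.finite_toSet.biUnion fun j _ => Set.finite_iUnion (@hA i j)
  have hlarge : {n | 1 < ‖(∑ i ∈ F, a i • indicatorSeq 𝕜 (A i)) n‖}.Finite := by
    refine hoverlap.subset fun n => ?_
    contrapose!
    intro hn
    simp only [Set.mem_iUnion, not_exists] at hn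
    simpa [indicatorSeq_apply] using norm_sum_mul_indicator_le_one (𝕜 := 𝕜)
      (fun i hi j hj hni hnj => by_contra fun hij => hn i hi j hj hij ⟨hni, hnj⟩) ha
  simpa using norm_apply_le_of_finite hS zero_le_one hlarge

theorem not_exists_null_biorthogonal (ψ : ℕ → StrongDual 𝕜 (ℕ →ᵇ 𝕜))
    (hψ : ∀ n m, ψ n (indicatorSeq 𝕜 {m}) = if n = m then 1 else 0) :
    ¬ ∀ a, Tendsto (fun n => ψ n a) atTop (𝓝 0) := by
  intro hnull
  obtain ⟨A, hA_inf, hA⟩ := exists_uncountable_almostDisjoint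
  let S (n : ℕ) : StrongDual 𝕜 (ℕ →ᵇ 𝕜) := BoundedContinuousFunction.evalCLM 𝕜 n - ψ n
  have hS (n : ℕ) (a : ℕ →ᵇ 𝕜) : S n a = a n - ψ n a := rfl
  have hcount : (⋃ n, {x | S n (indicatorSeq 𝕜 (A x)) ≠ 0}).Countable :=
    Set.countable_iUnion fun n => countable_apply_indicatorSeq_ne_zero hA fun m => by
      simp [hS, hψ, indicatorSeq_apply, Set.indicator_apply]
  have huncount : Uncountable (ℕ → Bool) :=
    Cardinal.aleph0_lt_mk_iff.1 (by simp [Cardinal.aleph0_lt_continuum])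
  obtain ⟨x, hx⟩ : ∃ x, x ∉ ⋃ n, {x | S n (indicatorSeq 𝕜 (A x)) ≠ 0} := by
    by_contra! h
    rw [Set.eq_univ_of_forall h, Set.countable_univ_iff] at hcount
    exact not_countable hcount
  have hval (n : ℕ) : ψ n (indicatorSeq 𝕜 (A x)) = indicatorSeq 𝕜 (A x) n :=
    (sub_eq_zero.1 (not_not.1 fun h => hx (Set.mem_iUnion.2 ⟨n, h⟩))).symm
  have hlim := hnull (indicatorSeq 𝕜 (A x))
  simp only [hval] at hlim
  obtain ⟨N, hN⟩ := eventually_atTop.1 (hlim.norm.eventually_lt_const (u := 1) (by simp))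
  obtain ⟨n, hn, hNn⟩ := (hA_inf x).exists_gt N
  simpa [indicatorSeq_apply, hn] using hN n hNn.le

theorem not_isComplementedInBidual_of_null_biorthogonal {X : Type*} [NormedAddCommGroup X]
    [NormedSpace 𝕜 X] {u : ℕ → X} {C : ℝ} (hu : HasUnconditionalBound 𝕜 u C)
    (Q : ℕ → StrongDual 𝕜 X) (hQu : ∀ n m, Q n (u m) = if n = m then 1 else 0)
    (hQ : ∀ x, Tendsto (fun n => Q n x) atTop (𝓝 0)) : ¬ IsComplementedInBidual 𝕜 X := by
  rintro ⟨P, hP⟩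
  obtain ⟨T, hT⟩ := hu.exists_bidual_sum
  have hT_unit (m : ℕ) :
      T (indicatorSeq 𝕜 {m}) = NormedSpace.inclusionInDoubleDual 𝕜 X (u m) := by
    ext φ
    rw [hT, NormedSpace.dual_def, tsum_eq_single m fun n hn => by simp [indicatorSeq_apply, hn]]
    simp [indicatorSeq_apply]
  exact not_exists_null_biorthogonal (fun n => (Q n).comp (P.comp T))
    (fun n m => by simp [hT_unit, hP, hQu]) fun a => hQ _

end Phillips

section LebesgueBochner

variable {α E 𝕜 : Type*} {mα : MeasurableSpace α} {μ : Measure α} [NormedAddCommGroup E]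
  [RCLike 𝕜] [NormedSpace 𝕜 E] {p q : ℝ≥0∞}

theorem coeFn_lp_sum_smul {ι : Type*} (F : Finset ι) (a : ι → 𝕜) (f : ι → Lp E p μ) :
    ⇑(∑ i ∈ F, a i • f i) =ᵐ[μ] fun x => ∑ i ∈ F, a i • f i x := by
  have hsmul : ∀ᵐ x ∂μ, ∀ i ∈ F, (a i • f i) x = a i • f i x :=
    (Finset.eventually_all F).2 fun i _ => Lp.coeFn_smul (a i) (f i)
  filter_upwards [Lp.coeFn_fun_finsetSum F fun i => a i • f i, hsmul] with x hsum hx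
  rw [hsum]
  exact Finset.sum_congr rfl hx

theorem integrable_coeFn_lp [IsFiniteMeasure μ] [Fact (1 ≤ p)] (f : Lp E p μ) : Integrable f μ :=
  (Lp.memLp f).integrable Fact.out

theorem lp_clm_ext [IsFiniteMeasure μ] [Fact (1 ≤ p)] {F : Type*} [NormedAddCommGroup F]
    [NormedSpace 𝕜 F] (hp : p ≠ ∞) {T T' : Lp E p μ →L[𝕜] F}
    (h : ∀ (A : Set α) (hA : MeasurableSet A) (a : E),
      T (indicatorConstLp p hA (measure_ne_top μ A) a) =
        T' (indicatorConstLp p hA (measure_ne_top μ A) a)) : T = T' := by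
  ext f
  induction f using Lp.induction hp with
  | indicatorConst a hA => exact h _ hA a
  | add _ _ _ hf hg => rw [map_add, map_add, hf, hg]
  | isClosed => exact isClosed_eq T.continuous T'.continuous

variable [IsProbabilityMeasure μ]

theorem norm_lp_le_of_ae_bound {f : Lp E p μ} {C : ℝ} (hC : 0 ≤ C) (h : ∀ᵐ x ∂μ, ‖f x‖ ≤ C) :
    ‖f‖ ≤ C := by
  simpa [measureUnivNNReal] using Lp.norm_le_of_ae_bound hC h

theorem integral_norm_coeFn_lp_le [Fact (1 ≤ p)] (f : Lp E p μ) : ∫ x, ‖f x‖ ∂μ ≤ ‖f‖ := by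
  rw [integral_norm_eq_lintegral_enorm (Lp.aestronglyMeasurable f),
    ← eLpNorm_one_eq_lintegral_enorm, Lp.norm_def]
  exact ENNReal.toReal_mono (Lp.eLpNorm_ne_top f)
    (eLpNorm_le_eLpNorm_of_exponent_le Fact.out (Lp.aestronglyMeasurable f))

theorem HasUnconditionalBound.lp [Fact (1 ≤ p)] {ι : Type*} {u : ι → Lp E p μ} {C : ℝ}
    (h : ∀ᵐ x ∂μ, HasUnconditionalBound 𝕜 (fun i => u i x) C) : HasUnconditionalBound 𝕜 u C := by
  obtain ⟨x₀, hx₀⟩ := h.exists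
  refine fun F a ha => norm_lp_le_of_ae_bound hx₀.nonneg ?_
  filter_upwards [h, coeFn_lp_sum_smul F a u] with x hx hsum
  rw [hsum]
  exact hx F a ha

theorem exists_dual_lp_eq_integral_mul [Fact (1 ≤ p)] {g : α → 𝕜} {M : ℝ}
    (hg : AEStronglyMeasurable g μ) (hgM : ∀ᵐ x ∂μ, ‖g x‖ ≤ M) (Q : StrongDual 𝕜 E) :
    ∃ T : StrongDual 𝕜 (Lp E p μ), ‖T‖ ≤ M * ‖Q‖ ∧ ∀ f, T f = ∫ x, g x * Q (f x) ∂μ := by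
  obtain ⟨x₀, hx₀⟩ := hgM.exists
  have hM : 0 ≤ M := (norm_nonneg _).trans hx₀
  have : ENNReal.HolderConjugate p p.conjExponent := .conjExponent Fact.out
  have : Fact (1 ≤ p.conjExponent) := ⟨ENNReal.HolderConjugate.one_le p.conjExponent p⟩
  have hgp : MemLp g p.conjExponent μ := .of_bound hg M hgM
  let T : StrongDual 𝕜 (Lp E p μ) :=
    (ContinuousLinearMap.lpPairing μ p.conjExponent p (ContinuousLinearMap.mul 𝕜 𝕜) hgp.toLp).comp
      (Q.compLpL p μ)
  have hT (f : Lp E p μ) : T f = ∫ x, g x * Q (f x) ∂μ := by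
    refine (ContinuousLinearMap.lpPairing_eq_integral ..).trans (integral_congr_ae ?_)
    filter_upwards [hgp.coeFn_toLp, Q.coeFn_compLpL f] with x hgx hfx
    simp [hgx, hfx]
  refine ⟨T, T.opNorm_le_bound (by positivity) fun f => ?_, hT⟩
  calc ‖T f‖ ≤ ∫ x, M * ‖Q‖ * ‖f x‖ ∂μ := by
        rw [hT]
        refine norm_integral_le_of_norm_le ((integrable_coeFn_lp f).norm.const_mul _) ?_
        filter_upwards [hgM] with x hx
        rw [norm_mul, mul_assoc]
        gcongr
        exact Q.le_opNorm _
    _ ≤ M * ‖Q‖ * ‖f‖ := by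
        rw [integral_const_mul]
        gcongr
        exact integral_norm_coeFn_lp_le f

end LebesgueBochner

section OrthonormalWeights

variable {α E 𝕜 : Type*} {mα : MeasurableSpace α} {μ : Measure α} [NormedAddCommGroup E]
  [RCLike 𝕜] [NormedSpace 𝕜 E] {q : ℝ≥0∞} [Fact (1 ≤ q)] {r : ℕ → α → ℝ} {M : ℝ}

theorem tendsto_setIntegral_zero_of_orthonormal (hr : ∀ n, MemLp (r n) 2 μ)
    (horth : ∀ n m, ∫ x, r n x * r m x ∂μ = if n = m then 1 else 0) {A : Set α}
    (hA : MeasurableSet A) (hμA : μ A ≠ ∞) :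
    Tendsto (fun n => ∫ x in A, r n x ∂μ) atTop (𝓝 0) := by
  have hv : Orthonormal ℝ fun n => (hr n).toLp (r n) := by
    refine orthonormal_iff_ite.2 fun n m => ?_
    rw [← horth, L2.inner_def]
    refine integral_congr_ae ?_
    filter_upwards [(hr n).coeFn_toLp, (hr m).coeFn_toLp] with x hn hm
    simp [hn, hm, mul_comm]
  have hBessel := (hv.inner_products_summable (indicatorConstLp 2 hA hμA 1)).tendsto_atTop_zero
  have hnorm := (Real.continuous_sqrt.tendsto 0).comp hBessel
  rw [Real.sqrt_zero] at hnorm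
  refine tendsto_zero_iff_norm_tendsto_zero.2 (hnorm.congr fun n => ?_)
  rw [Function.comp_apply, Real.sqrt_sq (norm_nonneg _), real_inner_comm,
    L2.inner_indicatorConstLp_one]
  rw [setIntegral_congr_ae hA ((hr n).coeFn_toLp.mono fun _ hx _ => hx)]

theorem tendsto_dual_lp_zero_of_orthonormal (hq : q ≠ ∞) (hr : ∀ n, MemLp (r n) 2 μ)
    (horth : ∀ n m, ∫ x, r n x * r m x ∂μ = if n = m then 1 else 0) {Q : ℕ → StrongDual 𝕜 E}
    {K : ℝ} (hQ : ∀ n, ‖Q n‖ ≤ K) {T : ℕ → StrongDual 𝕜 (Lp E q μ)} {L : ℝ}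
    (hTL : ∀ n, ‖T n‖ ≤ L) (hT : ∀ n f, T n f = ∫ x, (r n x : 𝕜) * Q n (f x) ∂μ) (f : Lp E q μ) :
    Tendsto (fun n => T n f) atTop (𝓝 0) := by
  induction f using Lp.induction hq with
  | @indicatorConst c A hA hμA =>
    have hval (n : ℕ) :
        T n (indicatorConstLp q hA hμA.ne c) = (∫ x in A, r n x ∂μ : ℝ) * Q n c := by
      rw [hT, ← integral_ofReal, ← integral_mul_const, ← integral_indicator hA]
      refine integral_congr_ae ?_
      filter_upwards [indicatorConstLp_coeFn (p := q) (hs := hA) (hμs := hμA.ne) (c := c)] with x hx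
      rw [hx]
      by_cases hxA : x ∈ A <;> simp [hxA]
    simp only [Lp.simpleFunc.coe_indicatorConst, hval]
    have hlim :=
      (tendsto_setIntegral_zero_of_orthonormal hr horth hA hμA.ne).norm.mul_const (K * ‖c‖)
    rw [norm_zero, zero_mul] at hlim
    refine squeeze_zero_norm (fun n => ?_) hlim
    rw [norm_mul, RCLike.norm_ofReal, ← Real.norm_eq_abs]
    gcongr
    exact (Q n).le_of_opNorm_le (hQ n) c
  | add _ _ _ hf hg => simpa using hf.add hg
  | isClosed =>
    have hbdd : ∃ L, ∀ n, ‖T n‖ ≤ L := ⟨L, hTL⟩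
    have hequi := ((NormedSpace.equicontinuous_TFAE T).out 5 1).1 hbdd
    exact hequi.isClosed_setOfPred_tendsto continuous_const

/-- Emmanuele's theorem: `rₙ ⊗ eₙ` spans a complemented copy of `c_0` in `L_q(E)`. -/
theorem not_isComplementedInBidual_lp_of_orthonormal [IsProbabilityMeasure μ] (hq : q ≠ ∞)
    (hr : ∀ n, AEStronglyMeasurable (r n) μ) (hrM : ∀ n x, ‖r n x‖ ≤ M)
    (horth : ∀ n m, ∫ x, r n x * r m x ∂μ = if n = m then 1 else 0) {e : ℕ → E} {C : ℝ}
    (he : HasUnconditionalBound 𝕜 e C) (he_norm : ∀ n, ‖e n‖ = 1) :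
    ¬ IsComplementedInBidual 𝕜 (Lp E q μ) := by
  have hr' (n : ℕ) : AEStronglyMeasurable (fun x => (r n x : 𝕜)) μ :=
    RCLike.continuous_ofReal.comp_aestronglyMeasurable (hr n)
  have hrM' (n : ℕ) (x : α) : ‖(r n x : 𝕜)‖ ≤ M := by simpa using hrM n x
  choose Q hQ_norm hQe using fun n => exists_dual_vector 𝕜 (e n) (by simp [he_norm])
  choose T hTL hT using fun n =>
    exists_dual_lp_eq_integral_mul (p := q) (hr' n) (ae_of_all μ (hrM' n)) (Q n)
  simp only [hQ_norm, mul_one] at hTL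
  have hmem (n : ℕ) : MemLp (fun x => (r n x : 𝕜) • e n) q μ :=
    .of_bound ((hr' n).smul_const _) M (ae_of_all μ fun x => by
      simpa [norm_smul, he_norm] using hrM n x)
  let u (n : ℕ) : Lp E q μ := (hmem n).toLp
  have hu : HasUnconditionalBound 𝕜 u (M * C) := by
    refine HasUnconditionalBound.lp ?_
    filter_upwards [ae_all_iff.2 fun n => (hmem n).coeFn_toLp] with x hx
    simpa only [u, hx] using he.smul ((norm_nonneg _).trans (hrM 0 x)) fun n => hrM' n x
  have hTu (n m : ℕ) : T n (u m) = if n = m then 1 else 0 := by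
    have hint : T n (u m) = (∫ x, r n x * r m x ∂μ : ℝ) * Q n (e m) := by
      rw [hT, ← integral_ofReal, ← integral_mul_const]
      refine integral_congr_ae ?_
      filter_upwards [(hmem m).coeFn_toLp] with x hx
      simp only [u, hx, map_smul, smul_eq_mul, RCLike.ofReal_mul, mul_assoc]
    rw [hint, horth]
    split_ifs with h
    · simp [← h, hQe, he_norm]
    · simp
  refine not_isComplementedInBidual_of_null_biorthogonal hu T hTu fun f => ?_
  exact tendsto_dual_lp_zero_of_orthonormal hq (fun n => .of_bound (hr n) M (ae_of_all μ (hrM n)))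
    horth (fun n => (hQ_norm n).le) hTL hT f

end OrthonormalWeights

section UnitInterval

theorem integral_cos_two_pi_mul (k : ℤ) :
    ∫ t : unitInterval, Real.cos (2 * Real.pi * k * t) = if k = 0 then 1 else 0 := by
  split_ifs with hk
  · simp [hk]
  · have hc : 2 * Real.pi * k ≠ 0 := by positivity
    refine (integral_subtype measurableSet_Icc fun t : ℝ => Real.cos (2 * Real.pi * k * t)).trans ?_
    rw [integral_Icc_eq_integral_Ioc, ← intervalIntegral.integral_of_le zero_le_one,
      intervalIntegral.integral_comp_mul_left _ hc, integral_cos]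
    have hsin : Real.sin (2 * Real.pi * k) = 0 := by
      simpa [mul_comm, mul_left_comm] using Real.sin_int_mul_pi (2 * k)
    simp [hsin]

/-- The orthonormal sequence `√2 cos (2π(n+1)t)` in `L_2[0,1]`. -/
noncomputable def cosineWeight (n : ℕ) (t : unitInterval) : ℝ :=
  √2 * Real.cos (2 * Real.pi * (n + 1) * t)

theorem measurable_cosineWeight (n : ℕ) : Measurable (cosineWeight n) := by
  unfold cosineWeight
  fun_prop

theorem norm_cosineWeight_le (n : ℕ) (t : unitInterval) : ‖cosineWeight n t‖ ≤ √2 := by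
  rw [cosineWeight, norm_mul, Real.norm_of_nonneg (Real.sqrt_nonneg 2)]
  exact mul_le_of_le_one_right (Real.sqrt_nonneg 2) (Real.abs_cos_le_one _)

theorem integral_cosineWeight_mul (n m : ℕ) :
    ∫ t, cosineWeight n t * cosineWeight m t = if n = m then 1 else 0 := by
  have hprod (t : unitInterval) : cosineWeight n t * cosineWeight m t =
      Real.cos (2 * Real.pi * ((n - m : ℤ) : ℝ) * t) +
        Real.cos (2 * Real.pi * ((n + m + 2 : ℤ) : ℝ) * t) := by
    have hsqrt : √2 * √2 = 2 := Real.mul_self_sqrt zero_le_two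
    have hcos := Real.two_mul_cos_mul_cos (2 * Real.pi * (n + 1) * t) (2 * Real.pi * (m + 1) * t)
    simp only [cosineWeight]
    push_cast
    rw [mul_mul_mul_comm, hsqrt, ← mul_assoc, hcos]
    ring_nf
  have hint (k : ℤ) : Integrable fun t : unitInterval => Real.cos (2 * Real.pi * k * t) :=
    .of_bound (by fun_prop) 1 (ae_of_all _ fun t => Real.abs_cos_le_one _)
  simp only [hprod]
  rw [integral_add (hint _) (hint _), integral_cos_two_pi_mul, integral_cos_two_pi_mul,
    if_neg (show (n + m + 2 : ℤ) ≠ 0 by omega), add_zero]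
  simp only [sub_eq_zero, Nat.cast_inj]

theorem exists_pairwise_disjoint_unitInterval : ∃ B : ℕ → Set unitInterval,
    (∀ n, MeasurableSet (B n)) ∧ Pairwise (Function.onFun Disjoint B) ∧
      ∀ n, volume (B n) ≠ 0 := by
  let f : ℕ → unitInterval := fun n => ⟨1 / ((n : ℝ) + 1), by positivity, by
    rw [div_le_one (by positivity)]; linarith [n.cast_nonneg (α := ℝ)]⟩
  have hf : StrictAnti f := fun m n h => by
    change 1 / ((n : ℝ) + 1) < 1 / ((m : ℝ) + 1)
    gcongr
  refine ⟨fun n => Set.Ioc (f (n + 1)) (f n), fun n => measurableSet_Ioc,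
    hf.antitone.pairwise_disjoint_on_Ioc_succ, fun n => ?_⟩
  rw [unitInterval.volume_Ioc]
  simpa using hf n.lt_succ_self

variable {α β : Type*} [MeasurableSpace α] [MeasurableSpace β] {μ : Measure α} {ν : Measure β}
  (𝕜 : Type*) [RCLike 𝕜]

theorem exists_hasUnconditionalBound_lp_top [IsProbabilityMeasure ν] {ψ : β → unitInterval}
    (hψ : MeasurePreserving ψ ν volume) :
    ∃ e : ℕ → Lp 𝕜 ∞ ν, HasUnconditionalBound 𝕜 e 1 ∧ ∀ n, ‖e n‖ = 1 := by
  obtain ⟨B, hBm, hBd, hB0⟩ := exists_pairwise_disjoint_unitInterval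
  have hBψ (n : ℕ) : MeasurableSet (ψ ⁻¹' B n) := hψ.measurable (hBm n)
  refine ⟨fun n => indicatorConstLp ∞ (hBψ n) (measure_ne_top ν _) 1,
    HasUnconditionalBound.lp ?_, fun n => ?_⟩
  · have hcoe : ∀ᵐ x ∂ν, ∀ n, indicatorConstLp ∞ (hBψ n) (measure_ne_top ν _) (1 : 𝕜) x =
        (ψ ⁻¹' B n).indicator 1 x := ae_all_iff.2 fun n => indicatorConstLp_coeFn
    filter_upwards [hcoe] with x hx F a ha
    simp only [hx, smul_eq_mul]
    exact norm_sum_mul_indicator_le_one (fun n _ m _ hn hm => by_contra fun hnm =>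
      Set.disjoint_left.1 (hBd hnm) hn hm) ha
  · have h0 : ν (ψ ⁻¹' B n) ≠ 0 := by
      rw [hψ.measure_preimage (hBm n).nullMeasurableSet]
      exact hB0 n
    rw [norm_indicatorConstLp' ENNReal.top_ne_zero h0]
    simp

theorem not_isComplementedInBidual_lp_lp_top [IsProbabilityMeasure μ] [IsProbabilityMeasure ν]
    {φ : α → unitInterval} (hφ : MeasurePreserving φ μ volume) {ψ : β → unitInterval}
    (hψ : MeasurePreserving ψ ν volume) {q : ℝ≥0∞} [Fact (1 ≤ q)] (hq : q ≠ ∞) :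
    ¬ IsComplementedInBidual 𝕜 (Lp (Lp 𝕜 ∞ ν) q μ) := by
  obtain ⟨e, he, he_norm⟩ := exists_hasUnconditionalBound_lp_top 𝕜 hψ
  refine not_isComplementedInBidual_lp_of_orthonormal hq (r := fun n x => cosineWeight n (φ x))
    (fun n => ((measurable_cosineWeight n).comp hφ.measurable).aestronglyMeasurable)
    (fun n x => norm_cosineWeight_le n (φ x)) (fun n m => ?_) he he_norm
  rw [← integral_cosineWeight_mul, ← hφ.map_eq, integral_map hφ.aemeasurable]
  exact ((measurable_cosineWeight n).mul (measurable_cosineWeight m)).aestronglyMeasurable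

end UnitInterval

section CellDensity

variable {α K E : Type*} [MeasurableSpace K] {mα : MeasurableSpace α} {μ : Measure α}
  [NormedAddCommGroup E] [NormedSpace ℝ E] {c : α → K} {m : K → E}

/-- The density with respect to `μ` of the set function with value `m k` on the cell `c⁻¹{k}`: it
equals `m k / μ (c⁻¹{k})` there, and `0` on null cells because `0⁻¹ = 0`. -/
noncomputable def cellDensity (μ : Measure α) (c : α → K) (m : K → E) (x : α) : E :=
  (μ.real (c ⁻¹' {c x}))⁻¹ • m (c x)

theorem stronglyMeasurable_comap_cellDensity [Countable K] [DiscreteMeasurableSpace K]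
    (μ : Measure α) (c : α → K) (m : K → E) :
    StronglyMeasurable[MeasurableSpace.comap c inferInstance] (cellDensity μ c m) :=
  (StronglyMeasurable.of_discrete (f := fun k => (μ.real (c ⁻¹' {k}))⁻¹ • m k)).comp_measurable
    (comap_measurable c)

theorem stronglyMeasurable_cellDensity [Countable K] [DiscreteMeasurableSpace K]
    (hc : Measurable c) : StronglyMeasurable (cellDensity μ c m) :=
  (stronglyMeasurable_comap_cellDensity μ c m).mono hc.comap_le

theorem setIntegral_cellDensity [IsFiniteMeasure μ] [CompleteSpace E] [MeasurableSingletonClass K]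
    (hc : Measurable c) {k : K} (hm : μ (c ⁻¹' {k}) = 0 → m k = 0) :
    ∫ x in c ⁻¹' {k}, cellDensity μ c m x ∂μ = m k := by
  have hconst : ∫ x in c ⁻¹' {k}, cellDensity μ c m x ∂μ =
      ∫ _ in c ⁻¹' {k}, (μ.real (c ⁻¹' {k}))⁻¹ • m k ∂μ := by
    refine setIntegral_congr_fun (hc (measurableSet_singleton k)) fun x hx => ?_
    simp only [cellDensity, show c x = k from hx]
  rw [hconst, setIntegral_const, smul_smul]
  by_cases h0 : μ.real (c ⁻¹' {k}) = 0
  · simp [hm ((measureReal_eq_zero_iff (by finiteness)).1 h0)]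
  · rw [mul_inv_cancel₀ h0, one_smul]

theorem setIntegral_preimage_eq_sum [MeasurableSingletonClass K] (hc : Measurable c)
    (B : Finset K) {f : α → E} (hf : Integrable f μ) :
    ∫ x in c ⁻¹' B, f x ∂μ = ∑ k ∈ B, ∫ x in c ⁻¹' {k}, f x ∂μ := by
  have h : c ⁻¹' B = ⋃ k ∈ B, c ⁻¹' {k} := by ext x; simp
  rw [h, integral_biUnion_finset B (fun k _ => hc (measurableSet_singleton k)) ?_
    fun k _ => hf.integrableOn]
  exact fun i _ j _ hij => Disjoint.preimage c (by simpa using hij)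

variable [Finite K] [DiscreteMeasurableSpace K] [IsFiniteMeasure μ]

theorem memLp_cellDensity (hc : Measurable c) (m : K → E) (p : ℝ≥0∞) :
    MemLp (cellDensity μ c m) p μ := by
  obtain ⟨C, hC⟩ := (Set.finite_range fun k => ‖(μ.real (c ⁻¹' {k}))⁻¹ • m k‖).bddAbove
  exact .of_bound (stronglyMeasurable_cellDensity hc).aestronglyMeasurable C
    (.of_forall fun x => hC ⟨c x, rfl⟩)

theorem integrable_cellDensity (hc : Measurable c) (m : K → E) :
    Integrable (cellDensity μ c m) μ :=
  memLp_one_iff_integrable.1 (memLp_cellDensity hc m 1)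

theorem cellDensity_setIntegral_ae_eq_condExp [CompleteSpace E] (hc : Measurable c) {f : α → E}
    (hf : Integrable f μ) :
    cellDensity μ c (fun k => ∫ x in c ⁻¹' {k}, f x ∂μ) =ᵐ[μ]
      μ[f | MeasurableSpace.comap c inferInstance] := by
  have hint := integrable_cellDensity (μ := μ) hc fun k => ∫ x in c ⁻¹' {k}, f x ∂μ
  refine ae_eq_condExp_of_forall_setIntegral_eq hc.comap_le hf (fun s _ _ => hint.integrableOn) ?_
    (stronglyMeasurable_comap_cellDensity μ c _).aestronglyMeasurable
  rintro _ ⟨B, -, rfl⟩ -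
  lift B to Finset K using B.toFinite
  rw [setIntegral_preimage_eq_sum hc B hint, setIntegral_preimage_eq_sum hc B hf]
  refine Finset.sum_congr rfl fun k _ => setIntegral_cellDensity hc fun h0 => ?_
  rw [Measure.restrict_eq_zero.2 h0, integral_zero_measure]

end CellDensity

section MartingaleConvergence

variable {Ω 𝕜 : Type*} [RCLike 𝕜] {mΩ : MeasurableSpace Ω} {μ : Measure Ω} [IsFiniteMeasure μ]
  {ℱ : Filtration ℕ mΩ}

theorem martingale_clm_comp {E F : Type*} [NormedAddCommGroup E] [NormedSpace ℝ E]
    [CompleteSpace E] [NormedAddCommGroup F] [NormedSpace ℝ F] [CompleteSpace F] {f : ℕ → Ω → E}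
    (hf : Martingale f ℱ μ) (T : E →L[ℝ] F) : Martingale (fun n => T ∘ f n) ℱ μ := by
  refine martingale_nat (fun n => T.continuous.comp_stronglyMeasurable (hf.1 n))
    (fun n => T.integrable_comp (hf.integrable n)) fun n => ?_
  filter_upwards [T.comp_condExp_comm (m := ℱ n) (hf.integrable (n + 1)),
    hf.condExp_ae_eq n.le_succ] with x hT hx
  rw [← hT, Function.comp_apply, Function.comp_apply, hx]

theorem tendsto_of_tendsto_re_im {ι : Type*} {l : Filter ι} {u : ι → 𝕜} {a b : ℝ}
    (hre : Tendsto (fun n => RCLike.re (u n)) l (𝓝 a))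
    (him : Tendsto (fun n => RCLike.im (u n)) l (𝓝 b)) :
    Tendsto u l (𝓝 (a + b * RCLike.I)) := by
  have hofReal := (RCLike.continuous_ofReal (K := 𝕜)).tendsto
  simpa only [Function.comp_def, RCLike.re_add_im] using
    ((hofReal a).comp hre).add (((hofReal b).comp him).mul_const RCLike.I)

theorem exists_ae_tendsto_of_martingale_bdd {f : ℕ → Ω → 𝕜} (hf : Martingale f ℱ μ) {R : NNReal}
    (hR : ∀ n, eLpNorm (f n) 1 μ ≤ R) :
    ∃ g : Ω → 𝕜, StronglyMeasurable g ∧ ∀ᵐ x ∂μ, Tendsto (fun n => f n x) atTop (𝓝 (g x)) := by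
  have hre := (martingale_clm_comp hf RCLike.reCLM).submartingale.exists_ae_tendsto_of_bdd
    fun n => (eLpNorm_mono fun x => RCLike.norm_re_le_norm (f n x)).trans (hR n)
  have him := (martingale_clm_comp hf RCLike.imCLM).submartingale.exists_ae_tendsto_of_bdd
    fun n => (eLpNorm_mono fun x => RCLike.norm_im_le_norm (f n x)).trans (hR n)
  have hlim : ∀ᵐ x ∂μ, ∃ z, Tendsto (fun n => f n x) atTop (𝓝 z) := by
    filter_upwards [hre, him] with x ⟨a, ha⟩ ⟨b, hb⟩
    exact ⟨_, tendsto_of_tendsto_re_im ha hb⟩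
  obtain ⟨g, hg, hfg⟩ := measurable_limit_of_tendsto_metrizable_ae
    (fun n => (hf.integrable n).aemeasurable) hlim
  exact ⟨g, hg.stronglyMeasurable, hfg⟩

theorem ae_tendsto_condExp_of_iSup_eq (hℱ : ⨆ n, ℱ n = mΩ) {f : Ω → 𝕜} (hf : Integrable f μ) :
    ∀ᵐ x ∂μ, Tendsto (fun n => (μ[f | ℱ n]) x) atTop (𝓝 (f x)) := by
  have hreal {g : Ω → ℝ} (hg : Integrable g μ) :
      ∀ᵐ x ∂μ, Tendsto (fun n => (μ[g | ℱ n]) x) atTop (𝓝 (g x)) := by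
    have hsup : μ[g | ⨆ n, ℱ n] =ᵐ[μ] g := by
      rw [hℱ]
      exact condExp_of_aestronglyMeasurable' le_rfl hg.aestronglyMeasurable hg
    filter_upwards [tendsto_ae_condExp (ℱ := ℱ) g, hsup] with x hx hgx
    rwa [hgx] at hx
  filter_upwards [hreal hf.re, hreal hf.im,
    ae_all_iff.2 fun n => RCLike.reCLM.comp_condExp_comm (m := ℱ n) hf,
    ae_all_iff.2 fun n => RCLike.imCLM.comp_condExp_comm (m := ℱ n) hf] with x hre him hre' him'
  rw [← RCLike.re_add_im (f x)]
  exact tendsto_of_tendsto_re_im (hre.congr fun n => (hre' n).symm)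
    (him.congr fun n => (him' n).symm)

end MartingaleConvergence

section RefiningPartitions

variable {γ : Type*} [mγ : MeasurableSpace γ] {K : ℕ → Type*} [∀ n, MeasurableSpace (K n)]
  {c : ∀ n, γ → K n} {π : ∀ n, K (n + 1) → K n}

/-- The cells `(c n)⁻¹{k}` form a refining sequence of measurable partitions, the cell
`(c (n + 1))⁻¹{k}` being contained in `(c n)⁻¹{π n k}`. -/
structure IsRefining (c : ∀ n, γ → K n) (π : ∀ n, K (n + 1) → K n) : Prop where
  measurable (n : ℕ) : Measurable (c n)
  parent (n : ℕ) (x : γ) : π n (c (n + 1) x) = c n x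

namespace IsRefining

theorem prodMap {δ : Type*} [MeasurableSpace δ] {L : ℕ → Type*} [∀ n, MeasurableSpace (L n)]
    {d : ∀ n, δ → L n} {ρ : ∀ n, L (n + 1) → L n} (hc : IsRefining c π) (hd : IsRefining d ρ) :
    IsRefining (fun n => Prod.map (c n) (d n)) (fun n => Prod.map (π n) (ρ n)) where
  measurable n := (hc.measurable n).prodMap (hd.measurable n)
  parent n x := Prod.ext (hc.parent n x.1) (hd.parent n x.2)

variable [∀ n, DiscreteMeasurableSpace (K n)]

/-- The filtration whose `n`-th σ-algebra is generated by the `n`-th partition. -/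
def filtration (hc : IsRefining c π) : Filtration ℕ mγ where
  seq n := MeasurableSpace.comap (c n) inferInstance
  mono' := monotone_nat_of_le_succ fun n => by
    rw [← funext (hc.parent n)]
    exact (Measurable.of_discrete.comp (comap_measurable (c (n + 1)))).comap_le
  le' n := (hc.measurable n).comap_le

theorem setIntegral_eq_sum [∀ n, Fintype (K n)] [∀ n, DecidableEq (K n)] (hc : IsRefining c π)
    {E : Type*} [NormedAddCommGroup E] [NormedSpace ℝ E] {μ : Measure γ} {f : γ → E}
    (hf : Integrable f μ) (n : ℕ) (k : K n) :
    ∫ x in c n ⁻¹' {k}, f x ∂μ = ∑ k' with π n k' = k, ∫ x in c (n + 1) ⁻¹' {k'}, f x ∂μ := by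
  rw [← setIntegral_preimage_eq_sum (hc.measurable (n + 1)) _ hf]
  congr 2
  ext x
  simp [hc.parent]

variable {μ : Measure γ} [IsFiniteMeasure μ] {E : Type*} [NormedAddCommGroup E] [NormedSpace ℝ E]
  [CompleteSpace E]

theorem martingale_cellDensity [∀ n, Fintype (K n)] [∀ n, DecidableEq (K n)]
    (hc : IsRefining c π) {m : ∀ n, K n → E}
    (hm : ∀ n k, m n k = ∑ k' with π n k' = k, m (n + 1) k')
    (h0 : ∀ n k, μ (c n ⁻¹' {k}) = 0 → m n k = 0) :
    Martingale (fun n => cellDensity μ (c n) (m n)) hc.filtration μ := by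
  have hint n := integrable_cellDensity (μ := μ) (hc.measurable n) (m n)
  refine martingale_nat (fun n => stronglyMeasurable_comap_cellDensity μ (c n) (m n)) hint
    fun n => ?_
  have hmn : m n = fun k => ∫ x in c n ⁻¹' {k}, cellDensity μ (c (n + 1)) (m (n + 1)) x ∂μ := by
    ext k
    rw [hc.setIntegral_eq_sum (hint (n + 1)), hm]
    exact Finset.sum_congr rfl fun k' _ =>
      (setIntegral_cellDensity (hc.measurable (n + 1)) (h0 (n + 1) k')).symm
  rw [hmn]
  exact cellDensity_setIntegral_ae_eq_condExp (hc.measurable n) (hint (n + 1))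

theorem ae_tendsto_cellDensity_setIntegral {𝕜 : Type*} [RCLike 𝕜] [∀ n, Finite (K n)]
    (hc : IsRefining c π) (hsup : ⨆ n, MeasurableSpace.comap (c n) inferInstance = mγ) {f : γ → 𝕜}
    (hf : Integrable f μ) :
    ∀ᵐ x ∂μ, Tendsto (fun n => cellDensity μ (c n) (fun k => ∫ y in c n ⁻¹' {k}, f y ∂μ) x) atTop
      (𝓝 (f x)) := by
  filter_upwards [ae_tendsto_condExp_of_iSup_eq (ℱ := hc.filtration) hsup hf,
    ae_all_iff.2 fun n => cellDensity_setIntegral_ae_eq_condExp (hc.measurable n) hf] with x hx hn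
  exact hx.congr fun n => (hn n).symm

end IsRefining

end RefiningPartitions

section BinaryCode

open MeasurableSpace

variable {α : Type*} [mα : MeasurableSpace α] [CountablyGenerated α]

/-- The first `n` binary digits of a point, recording to which sets of a generating sequence it
belongs. -/
noncomputable def binaryCode (n : ℕ) (a : α) (i : Fin n) : Bool :=
  mapNatBool α a i

theorem isRefining_binaryCode :
    IsRefining (binaryCode : ∀ n, α → Fin n → Bool) fun _ k i => k i.castSucc where
  measurable _ :=
    measurable_pi_lambda _ fun _ => (measurable_pi_apply _).comp (measurable_mapNatBool α)
  parent _ _ := rfl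

theorem le_iSup_comap_binaryCode :
    mα ≤ ⨆ n, MeasurableSpace.comap (binaryCode n : α → Fin n → Bool) inferInstance := by
  conv_lhs => rw [← generateFrom_natGeneratingSequence α]
  refine generateFrom_le ?_
  rintro _ ⟨n, rfl⟩
  refine le_iSup (fun n => MeasurableSpace.comap (binaryCode n : α → Fin n → Bool) inferInstance)
    (n + 1) _ ⟨{k | k (Fin.last n) = true}, .of_discrete, ?_⟩
  ext a
  simp [binaryCode, mapNatBool]

variable {β : Type*} [mβ : MeasurableSpace β] [CountablyGenerated β]

theorem iSup_comap_prodMap_binaryCode :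
    ⨆ n, MeasurableSpace.comap (Prod.map (binaryCode n) (binaryCode n) :
      α × β → (Fin n → Bool) × (Fin n → Bool)) inferInstance = Prod.instMeasurableSpace := by
  refine le_antisymm (iSup_le fun n => ((isRefining_binaryCode.measurable n).prodMap
    (isRefining_binaryCode.measurable n)).comap_le) (sup_le ?_ ?_)
  all_goals
    refine (MeasurableSpace.comap_mono le_iSup_comap_binaryCode).trans ?_
    rw [MeasurableSpace.comap_iSup]
    refine iSup_mono fun n => ?_
    rw [MeasurableSpace.comap_comp]
  · exact (measurable_fst.comp (comap_measurable (Prod.map (binaryCode n) (binaryCode n)))).comap_le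
  · exact (measurable_snd.comp (comap_measurable (Prod.map (binaryCode n) (binaryCode n)))).comap_le

end BinaryCode

section SetIntegralLp

variable {α E : Type*} (𝕜 : Type*) [RCLike 𝕜] {mα : MeasurableSpace α} {μ : Measure α}
  [IsProbabilityMeasure μ] [NormedAddCommGroup E] [NormedSpace ℝ E] [NormedSpace 𝕜 E]
  [SMulCommClass ℝ 𝕜 E] {p : ℝ≥0∞} [Fact (1 ≤ p)]

/-- Integration over the set `A` as a bounded operator from `L_p(E)` to `E`. -/
noncomputable def setIntegralLp (A : Set α) : Lp E p μ →L[𝕜] E :=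
  LinearMap.mkContinuous
    { toFun := fun f => ∫ x in A, f x ∂μ
      map_add' := fun f g => by
        rw [integral_congr_ae (ae_restrict_of_ae (Lp.coeFn_add f g))]
        exact integral_add (integrable_coeFn_lp f).integrableOn (integrable_coeFn_lp g).integrableOn
      map_smul' := fun a f => by
        rw [integral_congr_ae (ae_restrict_of_ae (Lp.coeFn_smul a f))]
        exact integral_smul a f } 1
    fun f => calc
      ‖∫ x in A, f x ∂μ‖ ≤ ∫ x in A, ‖f x‖ ∂μ := norm_integral_le_integral_norm _
      _ ≤ ∫ x, ‖f x‖ ∂μ :=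
        setIntegral_le_integral (integrable_coeFn_lp f).norm (.of_forall fun _ => norm_nonneg _)
      _ ≤ 1 * ‖f‖ := (integral_norm_coeFn_lp_le f).trans_eq (one_mul _).symm

theorem setIntegralLp_apply (A : Set α) (f : Lp E p μ) :
    setIntegralLp 𝕜 A f = ∫ x in A, f x ∂μ :=
  rfl

theorem setIntegralLp_eq_zero {A : Set α} (hA : μ A = 0) :
    (setIntegralLp 𝕜 A : Lp E p μ →L[𝕜] E) = 0 := by
  ext f
  rw [setIntegralLp_apply, Measure.restrict_eq_zero.2 hA, integral_zero_measure, zero_apply]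

theorem IsRefining.setIntegralLp_eq_sum {K : ℕ → Type*} [∀ n, MeasurableSpace (K n)]
    [∀ n, DiscreteMeasurableSpace (K n)] [∀ n, Fintype (K n)] [∀ n, DecidableEq (K n)]
    {c : ∀ n, α → K n} {π : ∀ n, K (n + 1) → K n} (hc : IsRefining c π) (n : ℕ) (k : K n) :
    (setIntegralLp 𝕜 (c n ⁻¹' {k}) : Lp E p μ →L[𝕜] E) =
      ∑ k' with π n k' = k, setIntegralLp 𝕜 (c (n + 1) ⁻¹' {k'}) := by
  ext f
  rw [sum_apply]
  exact hc.setIntegral_eq_sum (integrable_coeFn_lp f) n k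

end SetIntegralLp

section CellDensityLp

variable {α K E 𝕜 : Type*} [RCLike 𝕜] [MeasurableSpace K] [DiscreteMeasurableSpace K] [Finite K]
  {mα : MeasurableSpace α} {μ : Measure α} [IsFiniteMeasure μ] [NormedAddCommGroup E]
  [NormedSpace ℝ E] [NormedSpace 𝕜 E] [SMulCommClass ℝ 𝕜 E] {p : ℝ≥0∞} {c : α → K}

variable (𝕜 μ p) in
/-- `cellDensity` as a linear map into `L_p(E)`. -/
noncomputable def cellDensityLp (hc : Measurable c) : (K → E) →ₗ[𝕜] Lp E p μ where
  toFun m := (memLp_cellDensity hc m p).toLp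
  map_add' m m' := by
    rw [← MemLp.toLp_add]
    exact MemLp.toLp_congr _ _ (.of_forall fun x => smul_add _ _ _)
  map_smul' a m := by
    rw [RingHom.id_apply, ← MemLp.toLp_const_smul]
    exact MemLp.toLp_congr _ _ (.of_forall fun x => smul_comm _ _ _)

theorem coeFn_cellDensityLp (hc : Measurable c) (m : K → E) :
    cellDensityLp 𝕜 μ p hc m =ᵐ[μ] cellDensity μ c m :=
  (memLp_cellDensity hc m p).coeFn_toLp

theorem norm_cellDensityLp_mono {F : Type*} [NormedAddCommGroup F] [NormedSpace ℝ F]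
    [NormedSpace 𝕜 F] [SMulCommClass ℝ 𝕜 F] (hc : Measurable c) {m : K → E} {m' : K → F}
    (h : ∀ k, ‖m k‖ ≤ ‖m' k‖) : ‖cellDensityLp 𝕜 μ p hc m‖ ≤ ‖cellDensityLp 𝕜 μ p hc m'‖ := by
  refine Lp.norm_le_norm_of_ae_le ?_
  filter_upwards [coeFn_cellDensityLp (𝕜 := 𝕜) (p := p) (μ := μ) hc m,
    coeFn_cellDensityLp (𝕜 := 𝕜) (p := p) (μ := μ) hc m'] with x hx hx'
  rw [hx, hx', cellDensity, cellDensity, norm_smul, norm_smul]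
  gcongr
  exact h _

theorem norm_cellDensityLp_setIntegral_le [Fact (1 ≤ p)] [CompleteSpace E] (hc : Measurable c)
    (f : Lp E p μ) : ‖cellDensityLp 𝕜 μ p hc fun k => ∫ x in c ⁻¹' {k}, f x ∂μ‖ ≤ ‖f‖ := by
  rw [← enorm_le_iff_norm_le, Lp.enorm_def, Lp.enorm_def,
    eLpNorm_congr_ae ((coeFn_cellDensityLp hc _).trans
      (cellDensity_setIntegral_ae_eq_condExp hc (integrable_coeFn_lp f)))]
  exact eLpNorm_condExp_le_eLpNorm f Fact.out

end CellDensityLp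

section RectangleDensity

theorem norm_map_bidual_apply_le {ι 𝕜 X Y : Type*} [RCLike 𝕜] [Finite ι]
    [SeminormedAddCommGroup X] [NormedSpace 𝕜 X] [NormedAddCommGroup Y] [NormedSpace 𝕜 Y]
    (S : (ι → 𝕜) →ₗ[𝕜] Y) {φ : ι → StrongDual 𝕜 X} (hS : ∀ f, ‖S fun i => φ i f‖ ≤ ‖f‖)
    (x : StrongDual 𝕜 (StrongDual 𝕜 X)) : ‖S fun i => x (φ i)‖ ≤ ‖x‖ := by
  classical
  cases nonempty_fintype ι
  refine NormedSpace.norm_le_dual_bound 𝕜 _ (norm_nonneg x) fun ψ => ?_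
  let Φ : StrongDual 𝕜 X := ∑ i, ψ (S fun j => if i = j then 1 else 0) • φ i
  have hΦ_apply (f : X) : ψ (S fun i => φ i f) = Φ f := by
    rw [S.pi_apply_eq_sum_univ]
    simp [Φ, mul_comm]
  have hx_apply : ψ (S fun i => x (φ i)) = x Φ := by
    rw [S.pi_apply_eq_sum_univ]
    simp [Φ, mul_comm]
  have hΦ : ‖Φ‖ ≤ ‖ψ‖ := by
    refine Φ.opNorm_le_bound (norm_nonneg ψ) fun f => ?_
    rw [← hΦ_apply]
    exact ψ.le_opNorm_of_le (hS f)
  rw [hx_apply]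
  exact x.le_opNorm_of_le hΦ

variable {α β K L 𝕜 : Type*} [RCLike 𝕜] {mα : MeasurableSpace α} {mβ : MeasurableSpace β}
  {μ : Measure α} {ν : Measure β} {p q : ℝ≥0∞}

theorem prodMap_preimage_singleton (c : α → K) (d : β → L) (k : K × L) :
    Prod.map c d ⁻¹' {k} = (c ⁻¹' {k.1}) ×ˢ (d ⁻¹' {k.2}) := by
  ext z
  simp [Prod.ext_iff]

theorem cellDensity_prodMap [SFinite ν] (c : α → K) (d : β → L) (m : K × L → 𝕜) (s : α) (t : β) :
    cellDensity (μ.prod ν) (Prod.map c d) m (s, t) =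
      (μ.real (c ⁻¹' {c s}))⁻¹ • cellDensity ν d (fun l => m (c s, l)) t := by
  rw [cellDensity, Prod.map_apply, prodMap_preimage_singleton, measureReal_prod_prod, mul_inv,
    mul_smul, cellDensity]

variable [MeasurableSpace K] [DiscreteMeasurableSpace K] [Finite K] [MeasurableSpace L]
  [DiscreteMeasurableSpace L] [Finite L] [Fact (1 ≤ p)] {c : α → K} {d : β → L}

theorem eLpNorm_eLpNorm_cellDensity_prodMap [IsFiniteMeasure μ] [IsFiniteMeasure ν]
    (hc : Measurable c) (hd : Measurable d) (m : K × L → 𝕜) :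
    eLpNorm (fun s => eLpNorm (fun t => cellDensity (μ.prod ν) (Prod.map c d) m (s, t)) p ν) q μ =
      ‖cellDensityLp 𝕜 μ q hc fun k => cellDensityLp 𝕜 ν p hd fun l => m (k, l)‖ₑ := by
  rw [Lp.enorm_def, eLpNorm_congr_ae (coeFn_cellDensityLp hc _)]
  refine eLpNorm_congr_enorm_ae (.of_forall fun s => ?_)
  simp only [cellDensity_prodMap]
  rw [enorm_eq_self, cellDensity, enorm_smul, Lp.enorm_def,
    eLpNorm_congr_ae (coeFn_cellDensityLp hd _), ← eLpNorm_const_smul]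
  rfl

variable [IsProbabilityMeasure μ] [IsProbabilityMeasure ν] [Fact (1 ≤ q)]

variable (μ ν p q 𝕜) in
/-- Integration over the rectangle `A × B` as a functional on `L_q(L_p)`. -/
noncomputable def rectIntegral (A : Set α) (B : Set β) : StrongDual 𝕜 (Lp (Lp 𝕜 p ν) q μ) :=
  (setIntegralLp 𝕜 B).comp (setIntegralLp 𝕜 A)

theorem rectIntegral_apply (A : Set α) (B : Set β) (f : Lp (Lp 𝕜 p ν) q μ) :
    rectIntegral 𝕜 μ ν p q A B f = ∫ t in B, (∫ s in A, f s ∂μ : Lp 𝕜 p ν) t ∂ν :=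
  rfl

/-- The density, with respect to the partition of `α × β` into the rectangles `c⁻¹{k} × d⁻¹{l}`, of
the finitely additive set function `A × B ↦ x (1_A ⊗ 1_B)` represented by a bidual element `x` of
`L_q(L_p)`. -/
noncomputable def rectDensity (c : α → K) (d : β → L)
    (x : StrongDual 𝕜 (StrongDual 𝕜 (Lp (Lp 𝕜 p ν) q μ))) : α × β → 𝕜 :=
  cellDensity (μ.prod ν) (Prod.map c d)
    fun k => x (rectIntegral 𝕜 μ ν p q (c ⁻¹' {k.1}) (d ⁻¹' {k.2}))

theorem stronglyMeasurable_rectDensity (hc : Measurable c) (hd : Measurable d)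
    (x : StrongDual 𝕜 (StrongDual 𝕜 (Lp (Lp 𝕜 p ν) q μ))) :
    StronglyMeasurable (rectDensity c d x) :=
  stronglyMeasurable_cellDensity (hc.prodMap hd)

theorem eLpNorm_eLpNorm_rectDensity_le (hc : Measurable c) (hd : Measurable d)
    (x : StrongDual 𝕜 (StrongDual 𝕜 (Lp (Lp 𝕜 p ν) q μ))) :
    eLpNorm (fun s => eLpNorm (fun t => rectDensity c d x (s, t)) p ν) q μ ≤ ‖x‖ₑ := by
  let S : (K × L → 𝕜) →ₗ[𝕜] Lp (Lp 𝕜 p ν) q μ :=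
    cellDensityLp 𝕜 μ q hc ∘ₗ (cellDensityLp 𝕜 ν p hd).compLeft K ∘ₗ
      (LinearEquiv.curry 𝕜 𝕜 K L).toLinearMap
  have hS_apply (m : K × L → 𝕜) :
      S m = cellDensityLp 𝕜 μ q hc fun k => cellDensityLp 𝕜 ν p hd fun l => m (k, l) :=
    rfl
  have hS (f : Lp (Lp 𝕜 p ν) q μ) :
      ‖S fun k => rectIntegral 𝕜 μ ν p q (c ⁻¹' {k.1}) (d ⁻¹' {k.2}) f‖ ≤ ‖f‖ := by
    simp only [hS_apply, rectIntegral_apply]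
    exact (norm_cellDensityLp_mono hc fun k => norm_cellDensityLp_setIntegral_le hd _).trans
      (norm_cellDensityLp_setIntegral_le hc f)
  have hx := norm_map_bidual_apply_le S hS x
  rw [hS_apply, ← enorm_le_iff_norm_le] at hx
  exact (eLpNorm_eLpNorm_cellDensity_prodMap hc hd _).trans_le hx

end RectangleDensity

section MixedNormFatou

theorem stronglyMeasurable_of_measurable_dist {α E : Type*} {mα : MeasurableSpace α}
    [PseudoMetricSpace E] [SecondCountableTopology E] {f : α → E}
    (hf : ∀ y, Measurable fun x => dist (f x) y) : StronglyMeasurable f := by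
  let _ : MeasurableSpace E := borel E
  have : BorelSpace E := ⟨rfl⟩
  refine Measurable.stronglyMeasurable (measurable_of_isOpen fun U hU => ?_)
  choose! r hr hrU using fun y (hy : y ∈ U) => Metric.isOpen_iff.1 hU y hy
  obtain ⟨T, hT, hTU⟩ := TopologicalSpace.isOpen_iUnion_countable
    (fun y : U => Metric.ball (y : E) (r y)) fun y => Metric.isOpen_ball
  have hU' : U = ⋃ y ∈ T, Metric.ball (y : E) (r y) := by
    rw [hTU]
    refine Set.Subset.antisymm (fun y hy => ?_) (Set.iUnion_subset fun y => hrU y y.2)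
    exact Set.mem_iUnion.2 ⟨⟨y, hy⟩, Metric.mem_ball_self (hr y hy)⟩
  rw [hU', Set.preimage_iUnion₂]
  exact MeasurableSet.biUnion hT fun y _ => measurableSet_lt (hf y) measurable_const

theorem eLpNorm_liminf_le {α : Type*} {mα : MeasurableSpace α} {μ : Measure α} {q : ℝ≥0∞}
    (hq : q ≠ 0) {u : ℕ → α → ℝ≥0∞} (hu : ∀ n, Measurable (u n)) {C : ℝ≥0∞}
    (hC : ∀ n, eLpNorm (u n) q μ ≤ C) :
    eLpNorm (fun s => liminf (fun n => u n s) atTop) q μ ≤ C := by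
  rcases eq_or_ne q ∞ with rfl | hq_top
  · simp only [eLpNorm_exponent_top] at hC ⊢
    have hle : ∀ᵐ s ∂μ, ∀ n, u n s ≤ C := ae_all_iff.2 fun n => by
      filter_upwards [enorm_ae_le_eLpNormEssSup (u n) μ] with s hs using hs.trans (hC n)
    refine essSup_le_of_ae_le _ ?_
    filter_upwards [hle] with s hs
    exact liminf_le_of_frequently_le' (.of_forall hs)
  · have hr : 0 < q.toReal := ENNReal.toReal_pos hq hq_top
    simp only [eLpNorm_eq_lintegral_rpow_enorm_toReal hq hq_top, one_div,
      ENNReal.rpow_inv_le_iff hr, enorm_eq_self] at hC ⊢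
    calc ∫⁻ s, liminf (fun n => u n s) atTop ^ q.toReal ∂μ
        = ∫⁻ s, liminf (fun n => u n s ^ q.toReal) atTop ∂μ :=
          lintegral_congr fun s => (ENNReal.orderIsoRpow q.toReal hr).liminf_apply
      _ ≤ liminf (fun n => ∫⁻ s, u n s ^ q.toReal ∂μ) atTop :=
          lintegral_liminf_le fun n => (hu n).pow_const _
      _ ≤ C ^ q.toReal := liminf_le_of_frequently_le' (.of_forall hC)

variable {α β E : Type*} {mα : MeasurableSpace α} {mβ : MeasurableSpace β} {μ : Measure α}
  {ν : Measure β} [NormedAddCommGroup E] {p q : ℝ≥0∞}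

theorem measurable_eLpNorm_section [SFinite ν] (hp0 : p ≠ 0) (hp : p ≠ ∞) {h : α × β → E}
    (hh : StronglyMeasurable h) : Measurable fun s => eLpNorm (fun t => h (s, t)) p ν := by
  simp only [eLpNorm_eq_lintegral_rpow_enorm_toReal hp0 hp]
  exact ((hh.enorm.pow_const _).lintegral_prod_right').pow_const _

theorem eLpNorm_one_prod_le_eLpNorm_eLpNorm [IsProbabilityMeasure μ] [IsProbabilityMeasure ν]
    (hp1 : 1 ≤ p) (hp : p ≠ ∞) (hq1 : 1 ≤ q) {h : α × β → E} (hh : StronglyMeasurable h) :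
    eLpNorm h 1 (μ.prod ν) ≤ eLpNorm (fun s => eLpNorm (fun t => h (s, t)) p ν) q μ := by
  have hsec := measurable_eLpNorm_section (ν := ν) (zero_lt_one.trans_le hp1).ne' hp hh
  rw [eLpNorm_one_eq_lintegral_enorm, lintegral_prod _ hh.enorm.aemeasurable]
  calc ∫⁻ s, ∫⁻ t, ‖h (s, t)‖ₑ ∂ν ∂μ ≤ ∫⁻ s, eLpNorm (fun t => h (s, t)) p ν ∂μ := by
        refine lintegral_mono fun s => ?_
        rw [← eLpNorm_one_eq_lintegral_enorm]
        exact eLpNorm_le_eLpNorm_of_exponent_le hp1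
          (hh.comp_measurable measurable_prodMk_left).aestronglyMeasurable
    _ = eLpNorm (fun s => eLpNorm (fun t => h (s, t)) p ν) 1 μ := by
        simp only [eLpNorm_one_eq_lintegral_enorm, enorm_eq_self]
    _ ≤ _ := eLpNorm_le_eLpNorm_of_exponent_le hq1 hsec.aestronglyMeasurable

open Classical in
/-- The section `h (s, ·)` of a function on a product as an element of `L_p`, with the junk value
`0` if the section is not in `L_p`. -/
noncomputable def sectionLp (p : ℝ≥0∞) (ν : Measure β) (h : α × β → E) (s : α) : Lp E p ν :=
  if hs : MemLp (fun t => h (s, t)) p ν then hs.toLp else 0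

theorem measurable_dist_sectionLp [SFinite ν] (hp0 : p ≠ 0) (hp : p ≠ ∞) {h : α × β → E}
    (hh : StronglyMeasurable h) (g : Lp E p ν) :
    Measurable fun s => dist (sectionLp p ν h s) g := by
  classical
  have hmem : MeasurableSet {s | MemLp (fun t => h (s, t)) p ν} := by
    have hsec (s : α) : AEStronglyMeasurable (fun t => h (s, t)) ν :=
      (hh.comp_measurable measurable_prodMk_left).aestronglyMeasurable
    simp only [MemLp, hsec, true_and]
    exact measurableSet_lt (measurable_eLpNorm_section hp0 hp hh) measurable_const
  have hsub : StronglyMeasurable fun z : α × β => h z - g z.2 :=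
    hh.sub ((Lp.stronglyMeasurable g).comp_measurable measurable_snd)
  have hdist : (fun s => dist (sectionLp p ν h s) g) = fun s =>
      if MemLp (fun t => h (s, t)) p ν then (eLpNorm (fun t => h (s, t) - g t) p ν).toReal
      else dist 0 g := by
    ext s
    unfold sectionLp
    split_ifs with hs
    · rw [Lp.dist_def, eLpNorm_congr_ae (hs.coeFn_toLp.sub .rfl)]
      rfl
    · rfl
  rw [hdist]
  exact (measurable_eLpNorm_section hp0 hp hsub).ennreal_toReal.ite hmem measurable_const

theorem stronglyMeasurable_sectionLp [SFinite ν] [IsSeparable ν] [Fact (1 ≤ p)]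
    [TopologicalSpace.SeparableSpace E] (hp : p ≠ ∞) {h : α × β → E} (hh : StronglyMeasurable h) :
    StronglyMeasurable (sectionLp p ν h) :=
  have : Fact (p ≠ ∞) := ⟨hp⟩
  have hp0 : p ≠ 0 := (zero_lt_one.trans_le (Fact.out : 1 ≤ p)).ne'
  stronglyMeasurable_of_measurable_dist (measurable_dist_sectionLp hp0 hp hh)

theorem exists_lp_lp_ae_eq [IsProbabilityMeasure μ] [SFinite ν] [IsSeparable ν]
    [TopologicalSpace.SeparableSpace E] [Fact (1 ≤ p)] (hp : p ≠ ∞) (hq1 : 1 ≤ q) {h : α × β → E}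
    (hh : StronglyMeasurable h)
    (hfin : eLpNorm (fun s => eLpNorm (fun t => h (s, t)) p ν) q μ ≠ ∞) :
    ∃ f : Lp (Lp E p ν) q μ, (∀ᵐ s ∂μ, ∀ᵐ t ∂ν, f s t = h (s, t)) ∧
      ‖f‖ₑ = eLpNorm (fun s => eLpNorm (fun t => h (s, t)) p ν) q μ := by
  have hmeas : Measurable fun s => eLpNorm (fun t => h (s, t)) p ν :=
    measurable_eLpNorm_section (zero_lt_one.trans_le (Fact.out : 1 ≤ p)).ne' hp hh
  have hfin_one : ∫⁻ s, eLpNorm (fun t => h (s, t)) p ν ∂μ ≠ ∞ := by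
    have hle := eLpNorm_le_eLpNorm_of_exponent_le (μ := μ) hq1 hmeas.aestronglyMeasurable
    simp only [eLpNorm_one_eq_lintegral_enorm, enorm_eq_self] at hle
    exact ne_top_of_le_ne_top hfin hle
  have hmem : ∀ᵐ s ∂μ, MemLp (fun t => h (s, t)) p ν := (ae_lt_top hmeas hfin_one).mono fun s hs =>
    ⟨(hh.comp_measurable measurable_prodMk_left).aestronglyMeasurable, hs⟩
  have hnorm : eLpNorm (sectionLp p ν h) q μ =
      eLpNorm (fun s => eLpNorm (fun t => h (s, t)) p ν) q μ := by
    refine eLpNorm_congr_enorm_ae ?_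
    filter_upwards [hmem] with s hs
    rw [sectionLp, dif_pos hs, Lp.enorm_toLp, enorm_eq_self]
  have hsec : MemLp (sectionLp p ν h) q μ :=
    ⟨(stronglyMeasurable_sectionLp hp hh).aestronglyMeasurable, hnorm.trans_lt hfin.lt_top⟩
  refine ⟨hsec.toLp, ?_, (Lp.enorm_toLp hsec).trans hnorm⟩
  filter_upwards [hsec.coeFn_toLp, hmem] with s hs hs_mem
  rw [hs, sectionLp, dif_pos hs_mem]
  exact hs_mem.coeFn_toLp

theorem exists_lp_lp_of_tendsto [IsProbabilityMeasure μ] [SFinite ν] [IsSeparable ν]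
    [TopologicalSpace.SeparableSpace E] [Fact (1 ≤ p)] (hp : p ≠ ∞) (hq1 : 1 ≤ q)
    {u : ℕ → α × β → E} (hu : ∀ n, StronglyMeasurable (u n)) {h : α × β → E}
    (hh : StronglyMeasurable h)
    (ht : ∀ᵐ z ∂μ.prod ν, Tendsto (fun n => u n z) atTop (𝓝 (h z))) {C : ℝ≥0∞} (hC : C ≠ ∞)
    (huC : ∀ n, eLpNorm (fun s => eLpNorm (fun t => u n (s, t)) p ν) q μ ≤ C) :
    ∃ f : Lp (Lp E p ν) q μ, (∀ᵐ s ∂μ, ∀ᵐ t ∂ν, f s t = h (s, t)) ∧ ‖f‖ₑ ≤ C := by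
  have hp0 : p ≠ 0 := (zero_lt_one.trans_le (Fact.out : 1 ≤ p)).ne'
  have hq0 : q ≠ 0 := (zero_lt_one.trans_le hq1).ne'
  have hle : ∀ᵐ s ∂μ, eLpNorm (fun t => h (s, t)) p ν ≤
      liminf (fun n => eLpNorm (fun t => u n (s, t)) p ν) atTop := by
    filter_upwards [Measure.ae_ae_of_ae_prod ht] with s hs
    exact Lp.eLpNorm_lim_le_liminf_eLpNorm
      (fun n => ((hu n).comp_measurable measurable_prodMk_left).aestronglyMeasurable) _ hs
  have hbound : eLpNorm (fun s => eLpNorm (fun t => h (s, t)) p ν) q μ ≤ C :=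
    (eLpNorm_mono_enorm_ae hle).trans
      (eLpNorm_liminf_le hq0 (fun n => measurable_eLpNorm_section hp0 hp (hu n)) huC)
  obtain ⟨f, hf, hf_norm⟩ := exists_lp_lp_ae_eq hp hq1 hh (ne_top_of_le_ne_top hC hbound)
  exact ⟨f, hf, hf_norm.trans_le hbound⟩

end MixedNormFatou

section DensityProjection

open MeasurableSpace NormedSpace

variable {α β 𝕜 : Type*} [RCLike 𝕜] [mα : MeasurableSpace α] [mβ : MeasurableSpace β]
  {μ : Measure α} {ν : Measure β} [IsProbabilityMeasure μ] [IsProbabilityMeasure ν] {p q : ℝ≥0∞}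
  [Fact (1 ≤ p)] [Fact (1 ≤ q)] {K L : ℕ → Type*} {c : ∀ n, α → K n} {d : ∀ n, β → L n}

/-- The densities of `x` on the rectangles of the partitions given by `c n` and `d n` converge
almost everywhere to `f`. The exceptional set is an iterated one because `f` is a class of functions
with values in classes of functions, so that `(s, t) ↦ f s t` need not be jointly measurable. -/
def HasDensity (c : ∀ n, α → K n) (d : ∀ n, β → L n)
    (x : StrongDual 𝕜 (StrongDual 𝕜 (Lp (Lp 𝕜 p ν) q μ))) (f : Lp (Lp 𝕜 p ν) q μ) : Prop :=
  ∀ᵐ s ∂μ, ∀ᵐ t ∂ν, Tendsto (fun n => rectDensity (c n) (d n) x (s, t)) atTop (𝓝 (f s t))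

namespace HasDensity

variable {x y : StrongDual 𝕜 (StrongDual 𝕜 (Lp (Lp 𝕜 p ν) q μ))} {f g : Lp (Lp 𝕜 p ν) q μ}

theorem unique (hf : HasDensity c d x f) (hg : HasDensity c d x g) : f = g := by
  refine Lp.ext ?_
  filter_upwards [hf, hg] with s hfs hgs
  refine Lp.ext ?_
  filter_upwards [hfs, hgs] with t hft hgt using tendsto_nhds_unique hft hgt

theorem add (hf : HasDensity c d x f) (hg : HasDensity c d y g) :
    HasDensity c d (x + y) (f + g) := by
  filter_upwards [hf, hg, Lp.coeFn_add f g] with s hfs hgs hs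
  rw [hs, Pi.add_apply]
  filter_upwards [hfs, hgs, Lp.coeFn_add (f s) (g s)] with t hft hgt ht
  rw [ht, Pi.add_apply]
  exact (hft.add hgt).congr fun n => (smul_add _ _ _).symm

theorem smul (a : 𝕜) (hf : HasDensity c d x f) : HasDensity c d (a • x) (a • f) := by
  filter_upwards [hf, Lp.coeFn_smul a f] with s hfs hs
  rw [hs, Pi.smul_apply]
  filter_upwards [hfs, Lp.coeFn_smul a (f s)] with t hft ht
  rw [ht, Pi.smul_apply]
  exact (hft.const_smul a).congr fun n => smul_comm _ _ _

end HasDensity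

theorem rectIntegral_eq_zero {A : Set α} {B : Set β} (h : μ.prod ν (A ×ˢ B) = 0) :
    rectIntegral 𝕜 μ ν p q A B = 0 := by
  rw [Measure.prod_prod, mul_eq_zero] at h
  rcases h with h | h
  · rw [rectIntegral, setIntegralLp_eq_zero 𝕜 h, ContinuousLinearMap.comp_zero]
  · rw [rectIntegral, setIntegralLp_eq_zero 𝕜 h, ContinuousLinearMap.zero_comp]

theorem rectIntegral_indicatorConstLp {A : Set α} (hA : MeasurableSet A) (g : Lp 𝕜 p ν) {S : Set α}
    (hS : MeasurableSet S) (T : Set β) :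
    rectIntegral 𝕜 μ ν p q S T (indicatorConstLp q hA (measure_ne_top μ A) g) =
      ∫ z in S ×ˢ T, A.indicator 1 z.1 * g z.2 ∂μ.prod ν := by
  have hinner : ∫ s in S, indicatorConstLp q hA (measure_ne_top μ A) g s ∂μ =
      (∫ s in S, A.indicator 1 s ∂μ : 𝕜) • g := by
    rw [← integral_smul_const]
    refine setIntegral_congr_ae hS ?_
    filter_upwards [indicatorConstLp_coeFn (p := q) (hs := hA) (hμs := measure_ne_top μ A) (c := g)]
      with s hs _
    by_cases hsA : s ∈ A <;> simp [hs, hsA]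
  rw [rectIntegral_apply, hinner, setIntegral_prod_mul, ← integral_const_mul]
  exact integral_congr_ae (ae_restrict_of_ae (Lp.coeFn_smul _ g))

variable [∀ n, MeasurableSpace (K n)] [∀ n, DiscreteMeasurableSpace (K n)]
  [∀ n, MeasurableSpace (L n)] [∀ n, DiscreteMeasurableSpace (L n)] {π : ∀ n, K (n + 1) → K n}
  {ρ : ∀ n, L (n + 1) → L n}

theorem IsRefining.rectIntegral_eq_sum [∀ n, Fintype (K n)] [∀ n, DecidableEq (K n)]
    [∀ n, Fintype (L n)] [∀ n, DecidableEq (L n)] (hc : IsRefining c π) (hd : IsRefining d ρ)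
    (n : ℕ) (k : K n × L n) :
    rectIntegral 𝕜 μ ν p q (c n ⁻¹' {k.1}) (d n ⁻¹' {k.2}) =
      ∑ k' with Prod.map (π n) (ρ n) k' = k,
        rectIntegral 𝕜 μ ν p q (c (n + 1) ⁻¹' {k'.1}) (d (n + 1) ⁻¹' {k'.2}) := by
  have hfilter : Finset.univ.filter (fun k' => Prod.map (π n) (ρ n) k' = k) =
      Finset.univ.filter (fun i => π n i = k.1) ×ˢ Finset.univ.filter (fun j => ρ n j = k.2) := by
    ext k'
    simp [Prod.ext_iff]
  rw [hfilter, Finset.sum_product]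
  ext f
  simp only [rectIntegral, ContinuousLinearMap.comp_apply, sum_apply,
    hc.setIntegralLp_eq_sum 𝕜 n k.1, hd.setIntegralLp_eq_sum 𝕜 n k.2, map_sum]

variable [∀ n, Finite (K n)] [∀ n, Finite (L n)]

theorem IsRefining.martingale_rectDensity (hc : IsRefining c π) (hd : IsRefining d ρ)
    (x : StrongDual 𝕜 (StrongDual 𝕜 (Lp (Lp 𝕜 p ν) q μ))) :
    Martingale (fun n => rectDensity (c n) (d n) x) (hc.prodMap hd).filtration (μ.prod ν) := by
  classical
  have := fun n => Fintype.ofFinite (K n)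
  have := fun n => Fintype.ofFinite (L n)
  refine (hc.prodMap hd).martingale_cellDensity (fun n k => ?_) fun n k hk => ?_
  · rw [hc.rectIntegral_eq_sum hd, map_sum]
  · rw [prodMap_preimage_singleton] at hk
    rw [rectIntegral_eq_zero hk, map_zero]

theorem IsRefining.exists_hasDensity [IsSeparable ν] (hc : IsRefining c π) (hd : IsRefining d ρ)
    (hp : p ≠ ∞) (x : StrongDual 𝕜 (StrongDual 𝕜 (Lp (Lp 𝕜 p ν) q μ))) :
    ∃ f, HasDensity c d x f ∧ ‖f‖ ≤ ‖x‖ := by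
  have hu (n : ℕ) : StronglyMeasurable (rectDensity (c n) (d n) x) :=
    stronglyMeasurable_rectDensity (hc.measurable n) (hd.measurable n) x
  have hbound (n : ℕ) := eLpNorm_eLpNorm_rectDensity_le (hc.measurable n) (hd.measurable n) x
  obtain ⟨h, hh, ht⟩ := exists_ae_tendsto_of_martingale_bdd (hc.martingale_rectDensity hd x)
    (R := ‖x‖₊) fun n =>
      (eLpNorm_one_prod_le_eLpNorm_eLpNorm Fact.out hp Fact.out (hu n)).trans (hbound n)
  obtain ⟨f, hf, hf_norm⟩ := exists_lp_lp_of_tendsto hp Fact.out hu hh ht enorm_ne_top hbound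
  refine ⟨f, ?_, enorm_le_iff_norm_le.1 hf_norm⟩
  filter_upwards [hf, Measure.ae_ae_of_ae_prod ht] with s hfs hts
  filter_upwards [hfs, hts] with t hft htt
  rwa [hft]

theorem IsRefining.exists_hasDensity_clm [IsSeparable ν] (hc : IsRefining c π)
    (hd : IsRefining d ρ) (hp : p ≠ ∞) :
    ∃ P : StrongDual 𝕜 (StrongDual 𝕜 (Lp (Lp 𝕜 p ν) q μ)) →L[𝕜] Lp (Lp 𝕜 p ν) q μ,
      ∀ x, HasDensity c d x (P x) := by
  choose P hP hP_norm using hc.exists_hasDensity (𝕜 := 𝕜) (μ := μ) (ν := ν) (q := q) hd hp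
  exact ⟨LinearMap.mkContinuous
    { toFun := P
      map_add' := fun x y => (hP (x + y)).unique ((hP x).add (hP y))
      map_smul' := fun a x => (hP (a • x)).unique ((hP x).smul a) } 1
    fun x => (hP_norm x).trans_eq (one_mul _).symm, hP⟩

theorem IsRefining.hasDensity_indicatorConstLp (hc : IsRefining c π) (hd : IsRefining d ρ)
    (hsup : ⨆ n, MeasurableSpace.comap (Prod.map (c n) (d n)) inferInstance =
      (Prod.instMeasurableSpace : MeasurableSpace (α × β))) {A : Set α} (hA : MeasurableSet A)
    (g : Lp 𝕜 p ν) :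
    HasDensity c d (inclusionInDoubleDual 𝕜 (Lp (Lp 𝕜 p ν) q μ)
      (indicatorConstLp q hA (measure_ne_top μ A) g))
      (indicatorConstLp q hA (measure_ne_top μ A) g) := by
  have hF : Integrable (fun z : α × β => A.indicator (1 : α → 𝕜) z.1 * g z.2) (μ.prod ν) :=
    ((integrable_const (1 : 𝕜)).indicator hA).mul_prod (integrable_coeFn_lp g)
  have hlim := (hc.prodMap hd).ae_tendsto_cellDensity_setIntegral hsup hF
  filter_upwards [Measure.ae_ae_of_ae_prod hlim, indicatorConstLp_coeFn (p := q) (hs := hA)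
    (hμs := measure_ne_top μ A) (c := g)] with s hlim_s hs
  have hst (t : β) : indicatorConstLp q hA (measure_ne_top μ A) g s t =
      A.indicator (1 : α → 𝕜) s * g t := by
    by_cases hsA : s ∈ A <;> simp [hs, hsA]
  filter_upwards [hlim_s] with t hlim_t
  rw [hst]
  refine hlim_t.congr fun n => ?_
  rw [rectDensity]
  congr 1
  ext k
  rw [prodMap_preimage_singleton, dual_def,
    rectIntegral_indicatorConstLp hA g (hc.measurable n (measurableSet_singleton _))]

theorem IsRefining.hasDensity_of_indicatorConstLp [IsSeparable ν] (hc : IsRefining c π)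
    (hd : IsRefining d ρ) (hp : p ≠ ∞) (hq : q ≠ ∞)
    {T : Lp (Lp 𝕜 p ν) q μ →L[𝕜] StrongDual 𝕜 (StrongDual 𝕜 (Lp (Lp 𝕜 p ν) q μ))}
    (hT : ∀ (A : Set α) (hA : MeasurableSet A) (g : Lp 𝕜 p ν),
      HasDensity c d (T (indicatorConstLp q hA (measure_ne_top μ A) g))
        (indicatorConstLp q hA (measure_ne_top μ A) g)) (f : Lp (Lp 𝕜 p ν) q μ) :
    HasDensity c d (T f) f := by
  obtain ⟨P, hP⟩ := hc.exists_hasDensity_clm (𝕜 := 𝕜) (μ := μ) (ν := ν) (q := q) hd hp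
  have hPT : P.comp T = .id 𝕜 _ := lp_clm_ext hq fun A hA g => (hP _).unique (hT A hA g)
  have hf : P (T f) = f := DFunLike.congr_fun hPT f
  simpa only [hf] using hP (T f)

theorem IsRefining.hasDensity_inclusion [IsSeparable ν] (hc : IsRefining c π)
    (hd : IsRefining d ρ) (hsup : ⨆ n, MeasurableSpace.comap (Prod.map (c n) (d n)) inferInstance =
      (Prod.instMeasurableSpace : MeasurableSpace (α × β))) (hp : p ≠ ∞)
    (f : Lp (Lp 𝕜 p ν) q μ) : HasDensity c d (inclusionInDoubleDual 𝕜 _ f) f := by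
  have hf_one : MemLp f 1 μ := (Lp.memLp f).mono_exponent Fact.out
  have hdensity (n : ℕ) : rectDensity (c n) (d n) (inclusionInDoubleDual 𝕜 _ hf_one.toLp) =
      rectDensity (c n) (d n) (inclusionInDoubleDual 𝕜 _ f) := by
    simp only [rectDensity, dual_def, rectIntegral_apply,
      integral_congr_ae (ae_restrict_of_ae hf_one.coeFn_toLp)]
  have hlim := hc.hasDensity_of_indicatorConstLp hd hp ENNReal.one_ne_top
    (fun A hA g => hc.hasDensity_indicatorConstLp hd hsup hA g) hf_one.toLp
  filter_upwards [hlim, hf_one.coeFn_toLp] with s hs hfs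
  simpa only [hdensity, hfs] using hs

variable [CountablyGenerated α] [CountablyGenerated β]

variable (𝕜) in
theorem isComplementedInBidual_lp_lp (hp : p ≠ ∞) :
    IsComplementedInBidual 𝕜 (Lp (Lp 𝕜 p ν) q μ) := by
  obtain ⟨P, hP⟩ := isRefining_binaryCode.exists_hasDensity_clm (𝕜 := 𝕜) (μ := μ) (ν := ν) (q := q)
    isRefining_binaryCode hp
  exact ⟨P, fun f => (hP _).unique (isRefining_binaryCode.hasDensity_inclusion
    isRefining_binaryCode iSup_comap_prodMap_binaryCode hp f)⟩

end DensityProjection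

theorem theorem2p7_general (𝕜 : Type*) [RCLike 𝕜] {α β : Type*}
    [MeasurableSpace α] [MeasurableSpace.CountablyGenerated α]
    [MeasurableSpace β] [MeasurableSpace.CountablyGenerated β] {μ : Measure α} {ν : Measure β}
    [IsProbabilityMeasure μ] [IsProbabilityMeasure ν] {φ : α → unitInterval}
    (hφ : MeasurePreserving φ μ volume) {ψ : β → unitInterval} (hψ : MeasurePreserving ψ ν volume)
    (p q : ℝ≥0∞) [Fact (1 ≤ p)] [Fact (1 ≤ q)] (hpq : p ≠ ∞ ∨ q ≠ ∞) :
    IsComplementedInBidual 𝕜 (Lp (Lp 𝕜 p ν) q μ) ↔ p < ∞ := by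
  refine ⟨fun h => lt_top_iff_ne_top.2 ?_, fun hp => isComplementedInBidual_lp_lp 𝕜 hp.ne⟩
  rintro rfl
  exact not_isComplementedInBidual_lp_lp_top 𝕜 hφ hψ (hpq.resolve_left (· rfl)) h

theorem theorem2p7 (𝕜 : Type*) [RCLike 𝕜] (p q : ℝ≥0∞) [Fact (1 ≤ p)] [Fact (1 ≤ q)]
    (hpq : p ≠ q) :
    IsComplementedInBidual 𝕜 (MixedLp 𝕜 p q) ↔ p < ∞ :=
  theorem2p7_general 𝕜 (.id volume) (.id volume) p q
    (not_and_or.1 fun h => hpq (h.1.trans h.2.symm))
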